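/- For a norm $|\cdot|$ on a real vector space $X$ and $\varepsilon\in(0,2]$ let $$\delta_{|\cdot|}(\varepsilon)=\inf\Bigl\{1-\Bigl|\frac{x+y}{2}\Bigr| : x,y\in X,\ |x|\le 1,\ |y|\le 1,\ |x-y|\ge\varepsilon\Bigr\}$$ be its modulus of convexity (with $\inf\emptyset=+\infty$). A real Banach space $X$ is called $q$-convex if there are an equivalent norm $|\cdot|$ on $X$ and a constant $c>0$ such that $\delta_{|\cdot|}(\varepsilon)\ge c\,\varepsilon^q$ for all $\varepsilon\in(0,2]$. Let $q\in[2,\infty)$. (1) Let $(X,\|\cdot\|)$ be a $q$-convex Banach space. Then there is a constant $\gamma\ge 1$, depending only on $X$ and $q$, such that for every integer $n\ge 2$ and all $x_1,\dots,x_n\in X$ with $\|x_i\|\le 1$ there exist nonempty sets $A,B\subset\{1,\dots,n\}$ with $\max A<\min B$ and $$\Biggl\|\frac{1}{|A|}\sum_{i\in A}x_i-\frac{1}{|B|}\sum_{j\in B}x_j\Biggr\|\le\frac{\gamma}{(\log_2 n)^{1/q}}.$$ (2) If the norm $\|\cdot\|$ of $X$ itself satisfies $\delta_{\|\cdot\|}(\varepsilon)\ge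 c\,\varepsilon^q$ for all $\varepsilon\in(0,2]$, then $\gamma$ can be chosen to depend only on $c$ and $q$. That is, for every $c>0$ there is $\gamma=\gamma(c,q)\ge 1$ such that the conclusion of (1) holds with this $\gamma$ for all Banach spaces $(X,\|\cdot\|)$ with $\delta_{\|\cdot\|}(\varepsilon)\ge c\,\varepsilon^q$ on $(0,2]$, all $n\ge 2$ and all $x_1,\dots,x_n$ in the unit ball of $X$. -/

import Mathlib

universe u

noncomputable section

/-- The modulus of convexity at `ε` of a norm `p` on `X`: the infimum of `1 - p ((x + y) / 2)` over
all `x, y` in the closed `p`-unit ball with `p (x - y) ≥ ε`. It is computed in the extended reals,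
so that the infimum over the empty set (which occurs only for the zero space or `ε > 2`) is `+∞`. -/
def convexityModulus {X : Type*} [AddCommGroup X] [Module ℝ X] (p : Seminorm ℝ X) (ε : ℝ) :
    EReal :=
  sInf {t : EReal | ∃ x y : X, p x ≤ 1 ∧ p y ≤ 1 ∧ ε ≤ p (x - y) ∧
    t = ((1 - p ((1 / 2 : ℝ) • (x + y)) : ℝ) : EReal)}

/-- The modulus of convexity of `p` is at least `c * ε ^ q` for every `ε ∈ (0, 2]`. -/
def HasConvexityPowerType {X : Type*} [AddCommGroup X] [Module ℝ X] (p : Seminorm ℝ X)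
    (c q : ℝ) : Prop :=
  ∀ ε : ℝ, 0 < ε → ε ≤ 2 → ((c * ε ^ q : ℝ) : EReal) ≤ convexityModulus p ε

/-- `p` is a norm on `X` equivalent to the given one. -/
def IsEquivalentNorm {X : Type*} [NormedAddCommGroup X] [NormedSpace ℝ X] (p : Seminorm ℝ X) :
    Prop :=
  ∃ a b : ℝ, 0 < a ∧ 0 < b ∧ ∀ x : X, a * ‖x‖ ≤ p x ∧ p x ≤ b * ‖x‖

/-- `X` is `q`-convex: it admits an equivalent norm whose modulus of convexity is at least
`c * ε ^ q` on `(0, 2]` for some constant `c > 0`. -/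
def IsQConvex (X : Type*) [NormedAddCommGroup X] [NormedSpace ℝ X] (q : ℝ) : Prop :=
  ∃ p : Seminorm ℝ X, IsEquivalentNorm p ∧ ∃ c : ℝ, 0 < c ∧ HasConvexityPowerType p c q

end

/-!
If every two consecutive blocks of `2 ^ j` indices had averages at distance more than `η`, then
uniform convexity would make the average over a block of `2 ^ (j + 1)` indices, which is the
midpoint of the averages over its two halves, shorter than the bound for those halves by at least
`c * η ^ q` (`HasConvexityPowerType.midpoint_le`). Hence averages over blocks of `2 ^ j` indices
have norm at most `1 - j * (c * η ^ q)` (`HasConvexityPowerType.blockAverage_le`). With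
`k = ⌊log₂ n⌋` and `c * η ^ q = 2 / k`, the average over the first `2 ^ k` indices would have norm
at most `-1`. So some pair of consecutive blocks has averages at distance at most
`η = (2 / (c * k)) ^ (1 / q)`, and `k ≥ log₂ n / 2`. For an equivalent norm the argument is applied
after rescaling, at the cost of the ratio of the equivalence constants.
-/

/-- A norm of convexity power type `q`, scaled to the ball of radius `M ≤ 1`: the gain `c * η ^ q`
does not deteriorate for small `M`, because `M * (η / M) ^ q ≥ η ^ q`. -/
theorem HasConvexityPowerType.midpoint_le {X : Type*} [AddCommGroup X] [Module ℝ X]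
    {p : Seminorm ℝ X} {c q : ℝ} (h : HasConvexityPowerType p c q) (hc : 0 < c) (hq : 1 ≤ q)
    {u v : X} {M η : ℝ} (hM : M ≤ 1) (hη : 0 < η) (hu : p u ≤ M) (hv : p v ≤ M)
    (huv : η ≤ p (u - v)) :
    p ((1 / 2 : ℝ) • (u + v)) ≤ M - c * η ^ q := by
  have hη2 : η ≤ 2 * M := by linarith [map_sub_le_add p u v]
  have hM0 : 0 < M := by linarith
  have scale : ∀ w : X, p (M⁻¹ • w) = p w / M := fun w => by
    rw [map_smul_eq_mul, Real.norm_of_nonneg (inv_nonneg.2 hM0.le)]; ring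
  have key := (h (η / M) (by positivity) (by rw [div_le_iff₀ hM0]; exact hη2)).trans
    (sInf_le ⟨M⁻¹ • u, M⁻¹ • v, by rw [scale, div_le_one hM0]; exact hu,
      by rw [scale, div_le_one hM0]; exact hv, by rw [← smul_sub, scale]; gcongr, rfl⟩)
  rw [EReal.coe_le_coe_iff, ← smul_add, smul_comm, scale, Real.div_rpow hη.le hM0.le] at key
  have hpow : M ^ q ≤ M := by
    simpa using Real.rpow_le_rpow_of_exponent_ge hM0 hM hq
  have gain : c * η ^ q ≤ M * (c * (η ^ q / M ^ q)) := by
    have : η ^ q ≤ M * (η ^ q / M ^ q) := by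
      rw [← mul_div_assoc, le_div_iff₀ (by positivity), mul_comm M]
      gcongr
    nlinarith
  have : M * (p ((1 / 2 : ℝ) • (u + v)) / M) = p ((1 / 2 : ℝ) • (u + v)) := by field_simp
  nlinarith [mul_le_mul_of_nonneg_left key hM0.le]

/-- The indices in `Fin n` lying in the interval `[l, l + m)`. -/
def indexBlock (n l m : ℕ) : Finset (Fin n) :=
  Finset.univ.filter fun i => l ≤ i.val ∧ i.val < l + m

theorem mem_indexBlock {n l m : ℕ} {i : Fin n} :
    i ∈ indexBlock n l m ↔ l ≤ i.val ∧ i.val < l + m := by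
  simp [indexBlock]

theorem indexBlock_add (n l m m' : ℕ) :
    indexBlock n l (m + m') = indexBlock n l m ∪ indexBlock n (l + m) m' := by
  ext i
  simp only [Finset.mem_union, mem_indexBlock]
  omega

theorem disjoint_indexBlock (n l m m' : ℕ) :
    Disjoint (indexBlock n l m) (indexBlock n (l + m) m') := by
  rw [Finset.disjoint_left]
  intro i hi hi'
  rw [mem_indexBlock] at hi hi'
  omega

theorem indexBlock_one {n : ℕ} (i : Fin n) : indexBlock n i 1 = {i} := by
  ext k
  simp only [mem_indexBlock, Finset.mem_singleton, Fin.ext_iff]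
  omega

theorem card_indexBlock {n l m : ℕ} (h : l + m ≤ n) : (indexBlock n l m).card = m := by
  induction m with
  | zero =>
    rw [Finset.card_eq_zero, Finset.eq_empty_iff_forall_notMem]
    intro i hi
    rw [mem_indexBlock] at hi
    omega
  | succ m ih =>
    rw [indexBlock_add, Finset.card_union_of_disjoint (disjoint_indexBlock _ _ _ _),
      ih (by omega), indexBlock_one ⟨l + m, by omega⟩, Finset.card_singleton]

theorem indexBlock_nonempty {n l m : ℕ} (hm : 0 < m) (h : l + m ≤ n) :
    (indexBlock n l m).Nonempty := by
  rw [← Finset.card_pos, card_indexBlock h]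
  exact hm

/-- If averages over consecutive blocks of equal length `2 ^ i` are always at distance at least `η`,
then averages over blocks of length `2 ^ j` shrink linearly in `j`. -/
theorem HasConvexityPowerType.blockAverage_le {X : Type*} [AddCommGroup X] [Module ℝ X]
    {p : Seminorm ℝ X} {c q : ℝ} (h : HasConvexityPowerType p c q) (hc : 0 < c) (hq : 1 ≤ q)
    {n : ℕ} {x : Fin n → X} (hx : ∀ i, p (x i) ≤ 1) {η : ℝ} (hη : 0 < η)
    (hsep : ∀ j l : ℕ, l + 2 ^ j + 2 ^ j ≤ n →
      η ≤ p ((1 / (2 : ℝ) ^ j) • ∑ i ∈ indexBlock n l (2 ^ j), x i -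
        (1 / (2 : ℝ) ^ j) • ∑ i ∈ indexBlock n (l + 2 ^ j) (2 ^ j), x i)) (j : ℕ) :
    ∀ l : ℕ, l + 2 ^ j ≤ n →
      p ((1 / (2 : ℝ) ^ j) • ∑ i ∈ indexBlock n l (2 ^ j), x i) ≤ 1 - j * (c * η ^ q) := by
  induction j with
  | zero =>
    intro l hl
    have hln : l < n := by simpa using hl
    rw [pow_zero (2 : ℕ), indexBlock_one ⟨l, hln⟩]
    simpa using hx _
  | succ j ih =>
    intro l hl
    have hl' : l + 2 ^ j + 2 ^ j ≤ n := by rw [pow_succ] at hl; omega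
    have hgain : 0 ≤ j * (c * η ^ q) := by positivity
    have step := h.midpoint_le hc hq (by linarith) hη (ih l (Nat.le_of_add_right_le hl')) (ih (l + 2 ^ j) hl')
      (hsep j l hl')
    have split : (1 / (2 : ℝ) ^ (j + 1)) • ∑ i ∈ indexBlock n l (2 ^ (j + 1)), x i =
        (1 / 2 : ℝ) • ((1 / (2 : ℝ) ^ j) • ∑ i ∈ indexBlock n l (2 ^ j), x i +
          (1 / (2 : ℝ) ^ j) • ∑ i ∈ indexBlock n (l + 2 ^ j) (2 ^ j), x i) := by
      rw [pow_succ (2 : ℕ) j, mul_two, indexBlock_add, Finset.sum_union (disjoint_indexBlock _ _ _ _),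
        ← smul_add, smul_smul]
      congr 1
      rw [pow_succ]
      field_simp
    rw [split]
    push_cast
    linarith

theorem HasConvexityPowerType.exists_close_averages {X : Type*} [AddCommGroup X] [Module ℝ X]
    {p : Seminorm ℝ X} {c q : ℝ} (h : HasConvexityPowerType p c q) (hc : 0 < c) (hq : 1 ≤ q)
    {n : ℕ} (hn : 2 ≤ n) {x : Fin n → X} (hx : ∀ i, p (x i) ≤ 1) :
    ∃ (A B : Finset (Fin n)) (hA : A.Nonempty) (hB : B.Nonempty),
      A.max' hA < B.min' hB ∧
      p ((1 / (A.card : ℝ)) • ∑ i ∈ A, x i - (1 / (B.card : ℝ)) • ∑ j ∈ B, x j) ≤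
        (4 / c) ^ (1 / q) / (Real.logb 2 (n : ℝ)) ^ (1 / q) := by
  set k := Nat.log 2 n with hk
  have hk1 : 1 ≤ k := Nat.log_pos (by norm_num) hn
  have hk0 : (0 : ℝ) < k := by exact_mod_cast hk1
  have hn1 : (1 : ℝ) < n := by exact_mod_cast (by omega : 1 < n)
  have hlog : 0 < Real.logb 2 n := Real.logb_pos (by norm_num) hn1
  have hlogk : Real.logb 2 n ≤ 2 * k := by
    have : Real.logb 2 n ≤ k + 1 := by
      rw [Real.logb_le_iff_le_rpow (by norm_num) (by linarith)]
      exact_mod_cast (Nat.lt_pow_succ_log_self (by norm_num) n).le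
    have : (1 : ℝ) ≤ k := by exact_mod_cast hk1
    linarith
  set η : ℝ := (2 / (c * k)) ^ (1 / q) with hηdef
  have hη : 0 < η := by positivity
  have hηq : c * η ^ q = 2 / k := by
    rw [hηdef, ← Real.rpow_mul (by positivity), one_div_mul_cancel (by linarith), Real.rpow_one]
    field_simp
  have hηle : η ≤ (4 / c) ^ (1 / q) / (Real.logb 2 (n : ℝ)) ^ (1 / q) := by
    rw [← Real.div_rpow (by positivity) hlog.le]
    refine Real.rpow_le_rpow (by positivity) ?_ (by positivity)
    rw [div_div, div_le_div_iff₀ (by positivity) (by positivity)]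
    nlinarith
  by_contra hcon
  push Not at hcon
  have hbound := h.blockAverage_le hc hq hx hη (fun j l hl => by
    have hpos : 0 < 2 ^ j := by positivity
    have hlt : (indexBlock n l (2 ^ j)).max' (indexBlock_nonempty hpos (by omega)) <
        (indexBlock n (l + 2 ^ j) (2 ^ j)).min' (indexBlock_nonempty hpos hl) := by
      rw [Finset.max'_lt_iff]
      intro a ha
      rw [Finset.lt_min'_iff]
      intro b hb
      rw [mem_indexBlock] at ha hb
      rw [Fin.lt_def]
      omega
    have := hcon _ _ _ _ hlt
    rw [card_indexBlock (by omega), card_indexBlock hl] at this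
    push_cast at this
    exact hηle.trans this.le) k 0 (by rw [zero_add]; exact Nat.pow_log_le_self 2 (by omega))
  rw [hηq, mul_div_cancel₀ _ hk0.ne'] at hbound
  linarith [apply_nonneg p ((1 / (2 : ℝ) ^ k) • ∑ i ∈ indexBlock n 0 (2 ^ k), x i)]

theorem lemma3p1 (q : ℝ) (hq : 2 ≤ q) :
    (∀ (X : Type u) [NormedAddCommGroup X] [NormedSpace ℝ X] [CompleteSpace X],
      IsQConvex X q →
      ∃ γ : ℝ, 1 ≤ γ ∧ ∀ (n : ℕ), 2 ≤ n → ∀ x : Fin n → X, (∀ i, ‖x i‖ ≤ 1) →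
        ∃ (A B : Finset (Fin n)) (hA : A.Nonempty) (hB : B.Nonempty),
          A.max' hA < B.min' hB ∧
          ‖(1 / (A.card : ℝ)) • ∑ i ∈ A, x i - (1 / (B.card : ℝ)) • ∑ j ∈ B, x j‖ ≤
            γ / (Real.logb 2 (n : ℝ)) ^ (1 / q)) ∧
    (∀ c : ℝ, 0 < c →
      ∃ γ : ℝ, 1 ≤ γ ∧
        ∀ (X : Type u) [NormedAddCommGroup X] [NormedSpace ℝ X] [CompleteSpace X],
          HasConvexityPowerType (normSeminorm ℝ X) c q →
          ∀ (n : ℕ), 2 ≤ n → ∀ x : Fin n → X, (∀ i, ‖x i‖ ≤ 1) →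
            ∃ (A B : Finset (Fin n)) (hA : A.Nonempty) (hB : B.Nonempty),
              A.max' hA < B.min' hB ∧
              ‖(1 / (A.card : ℝ)) • ∑ i ∈ A, x i - (1 / (B.card : ℝ)) • ∑ j ∈ B, x j‖ ≤
                γ / (Real.logb 2 (n : ℝ)) ^ (1 / q)) := by
  have hq1 : 1 ≤ q := by linarith
  refine ⟨?_, ?_⟩
  · rintro X _ _ _ ⟨p, ⟨a, b, ha, hb, hab⟩, c, hc, hp⟩
    refine ⟨max 1 (b / a * (4 / c) ^ (1 / q)), le_max_left _ _, ?_⟩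
    intro n hn x hx
    have hscale : ∀ w : X, p (b⁻¹ • w) = p w / b := fun w => by
      rw [map_smul_eq_mul, Real.norm_of_nonneg (inv_nonneg.2 hb.le)]; ring
    obtain ⟨A, B, hA, hB, hlt, hle⟩ :=
      hp.exists_close_averages hc hq1 hn (x := fun i => b⁻¹ • x i) (fun i => by
        rw [hscale, div_le_one hb]
        exact (hab _).2.trans (mul_le_of_le_one_right hb.le (hx i)))
    refine ⟨A, B, hA, hB, hlt, ?_⟩
    rw [← Finset.smul_sum, ← Finset.smul_sum, smul_comm, smul_comm _ b⁻¹ (∑ j ∈ B, x j),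
      ← smul_sub, hscale, div_le_iff₀ hb] at hle
    have hn1 : (1 : ℝ) < n := by exact_mod_cast (by omega : 1 < n)
    have hlog : 0 < Real.logb 2 n := Real.logb_pos (by norm_num) hn1
    calc _ ≤ ((4 / c) ^ (1 / q) / Real.logb 2 n ^ (1 / q) * b) / a := by
          rw [le_div_iff₀ ha, mul_comm]
          exact (hab _).1.trans hle
      _ = b / a * (4 / c) ^ (1 / q) / Real.logb 2 n ^ (1 / q) := by ring
      _ ≤ _ := by
          gcongr
          exact le_max_right _ _
  · intro c hc
    refine ⟨max 1 ((4 / c) ^ (1 / q)), le_max_left _ _, ?_⟩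
    intro X _ _ _ hp n hn x hx
    obtain ⟨A, B, hA, hB, hlt, hle⟩ := hp.exists_close_averages hc hq1 hn (x := x) hx
    have hn1 : (1 : ℝ) < n := by exact_mod_cast (by omega : 1 < n)
    have hlog : 0 < Real.logb 2 n := Real.logb_pos (by norm_num) hn1
    refine ⟨A, B, hA, hB, hlt, hle.trans ?_⟩
    gcongr
    exact le_max_right _ _
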